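/- Let $G$ be a finite simple graph. A perfect matching of $G$ is a set of pairwise disjoint edges covering all vertices. For a perfect matching $M$ of $G$, the anti-forcing number $af(G,M)$ is the smallest cardinality of a set $S\subseteq E(G)\setminus M$ such that $M$ is the unique perfect matching of $G-S$. Let $Af(G)$ be the maximum of $af(G,M)$ over all perfect matchings $M$ of $G$, and let $r(G)=|E(G)|-|V(G)|+c(G)$ be the cyclomatic number of $G$, where $c(G)$ is the number of connected components of $G$ (so $r(G)=|E(G)|-|V(G)|+1$ if $G$ is connected). The graph $G$ is called elementary if it has a perfect matching and the edges of $G$ that belong to at least one perfect matching of $G$ form a connected subgraph of $G$. If $G$ is elementary, $r(G)\ge 2$ and $Af(G)=r(G)$, then $G$ has exactly one perfect matching $M$ with $af(G,M)=r(G)$. -/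

import Mathlib

namespace AntiForcing

variable {V : Type*}

/-- A set `M` of edges is a perfect matching of `G`: it is the edge set of a subgraph of `G`
that is a perfect matching in the sense of Mathlib. -/
def IsPerfectMatching (G : SimpleGraph V) (M : Set (Sym2 V)) : Prop :=
  ∃ H : G.Subgraph, H.IsPerfectMatching ∧ H.edgeSet = M

/-- `S` is an anti-forcing set of the perfect matching `M` of `G`: `S ⊆ E(G) \ M` and `M` is the
unique perfect matching of `G - S`. -/
def IsAntiForcingSet (G : SimpleGraph V) (M S : Set (Sym2 V)) : Prop :=
  S ⊆ G.edgeSet \ M ∧ ∀ N : Set (Sym2 V), IsPerfectMatching (G.deleteEdges S) N ↔ N = M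

/-- The anti-forcing number `af(G, M)` of a perfect matching `M` of a finite graph `G`: the
smallest size of an anti-forcing set of `M`. -/
noncomputable def af (G : SimpleGraph V) (M : Set (Sym2 V)) : ℕ :=
  sInf {n : ℕ | ∃ S : Set (Sym2 V), IsAntiForcingSet G M S ∧ S.ncard = n}

/-- The maximum anti-forcing number `Af(G)` of a finite graph `G`: the largest anti-forcing
number over all perfect matchings of `G`. -/
noncomputable def maxAf (G : SimpleGraph V) : ℕ :=
  sSup {n : ℕ | ∃ M : Set (Sym2 V), IsPerfectMatching G M ∧ af G M = n}

/-- The cyclomatic number `r(G)` of a finite graph: `|E(G)| - |V(G)| + c(G)`, where `c(G)` is the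
number of connected components (so `|E(G)| - |V(G)| + 1` if `G` is connected). -/
noncomputable def cyclomaticNumber (G : SimpleGraph V) : ℤ :=
  (G.edgeSet.ncard : ℤ) - (Nat.card V : ℤ) + (Nat.card G.ConnectedComponent : ℤ)

/-- The subgraph formed by the allowed edges of `G`, i.e. the edges that lie in some perfect
matching of `G`. If `G` has a perfect matching, every vertex is an end of an allowed edge, so
this graph has vertex set all of `V`. -/
def allowedSubgraph (G : SimpleGraph V) : SimpleGraph V :=
  SimpleGraph.fromEdgeSet {e | ∃ M : Set (Sym2 V), IsPerfectMatching G M ∧ e ∈ M}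

/-- `G` is elementary: it has a perfect matching and its allowed edges form a connected
subgraph. -/
def IsElementary (G : SimpleGraph V) : Prop :=
  (∃ M : Set (Sym2 V), IsPerfectMatching G M) ∧ (allowedSubgraph G).Connected

/-! The next facts show that the minimum and the maximum above are attained. -/

theorem IsPerfectMatching.subset {G : SimpleGraph V} {M : Set (Sym2 V)}
    (h : IsPerfectMatching G M) : M ⊆ G.edgeSet := by
  obtain ⟨H, -, rfl⟩ := h
  exact H.edgeSet_subset

theorem isPerfectMatching_iff {G : SimpleGraph V} {M : Set (Sym2 V)} :
    IsPerfectMatching G M ↔ M ⊆ G.edgeSet ∧ ∀ v, ∃! w, s(v, w) ∈ M := by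
  constructor
  · intro h
    refine ⟨h.subset, ?_⟩
    obtain ⟨H, hH, rfl⟩ := h
    simpa [SimpleGraph.Subgraph.isPerfectMatching_iff] using hH
  · rintro ⟨hM, h⟩
    refine ⟨⟨Set.univ, fun v w => s(v, w) ∈ M, fun hv => hM hv, fun _ => trivial,
      ⟨fun v w hv => by rwa [Sym2.eq_swap]⟩⟩, ?_, ?_⟩
    · rw [SimpleGraph.Subgraph.isPerfectMatching_iff]
      exact h
    · ext e
      induction e with
      | _ v w => exact Iff.rfl

theorem isAntiForcingSet_compl {G : SimpleGraph V} {M : Set (Sym2 V)}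
    (h : IsPerfectMatching G M) : IsAntiForcingSet G M (G.edgeSet \ M) := by
  refine ⟨subset_rfl, fun N => ?_⟩
  have hM := isPerfectMatching_iff.1 h
  have hE : (G.deleteEdges (G.edgeSet \ M)).edgeSet = M := by
    rw [SimpleGraph.edgeSet_deleteEdges, Set.sdiff_sdiff_cancel_left hM.1]
  rw [isPerfectMatching_iff, hE]
  constructor
  · rintro ⟨hN, hN'⟩
    refine Set.Subset.antisymm hN fun e => ?_
    induction e with
    | _ v w =>
      intro hvw
      obtain ⟨x, hx, -⟩ := hN' v
      rwa [(hM.2 v).unique hvw (hN hx)]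
  · rintro rfl
    exact ⟨subset_rfl, hM.2⟩

theorem exists_ncard_eq_af {G : SimpleGraph V} {M : Set (Sym2 V)}
    (h : IsPerfectMatching G M) :
    ∃ S : Set (Sym2 V), IsAntiForcingSet G M S ∧ S.ncard = af G M :=
  Nat.sInf_mem (s := {n : ℕ | ∃ S : Set (Sym2 V), IsAntiForcingSet G M S ∧ S.ncard = n})
    ⟨_, _, isAntiForcingSet_compl h, rfl⟩

theorem isGreatest_maxAf [Finite V] {G : SimpleGraph V}
    (h : ∃ M : Set (Sym2 V), IsPerfectMatching G M) :
    IsGreatest {n : ℕ | ∃ M : Set (Sym2 V), IsPerfectMatching G M ∧ af G M = n} (maxAf G) := by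
  have hfin : {n : ℕ | ∃ M : Set (Sym2 V), IsPerfectMatching G M ∧ af G M = n}.Finite :=
    (Set.toFinite {M : Set (Sym2 V) | IsPerfectMatching G M}).image (af G)
  obtain ⟨M, hM⟩ := h
  exact ⟨Nat.sSup_mem ⟨_, M, hM, rfl⟩ hfin.bddAbove, fun n hn => le_csSup hfin.bddAbove hn⟩

end AntiForcing

namespace AntiForcing

open SimpleGraph

variable {V : Type*}

/-! Keeping only a spanning tree that contains `M` shows `af(G, M) ≤ r(G)`. One more edge can be
kept, so that `af(G, M) < r(G)`, if some cycle passes through a vertex `v` by two edges outside `M`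
and avoids the `M`-partner of `v`: no perfect matching uses both edges, so a unicyclic graph built
around them still has `M` as its only perfect matching (`af_lt_cyclomaticNumber`). Suppose `M` and
`N` both attain `r(G)` and match `v` to `m ≠ n`. A third neighbour `x` would lie with `v` on a
cycle, as `vx` is not a bridge. From `x` the cycle must meet `m`, by extremality of `M`; before that
`n`, by that of `N`; before that `m` again, which is absurd. So `v` has degree 2. Connectedness
spreads this to all vertices, and `G` is a cycle, with `r(G) = 1`. -/

theorem IsPerfectMatching.mono {G G' : SimpleGraph V} {M : Set (Sym2 V)}
    (h : IsPerfectMatching G M) (hM : M ⊆ G'.edgeSet) : IsPerfectMatching G' M :=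
  isPerfectMatching_iff.2 ⟨hM, (isPerfectMatching_iff.1 h).2⟩

theorem IsPerfectMatching.adj {G : SimpleGraph V} {M : Set (Sym2 V)}
    (h : IsPerfectMatching G M) {v w : V} (hvw : s(v, w) ∈ M) : G.Adj v w :=
  h.subset hvw

theorem IsPerfectMatching.eq_of_mem {G : SimpleGraph V} {M : Set (Sym2 V)}
    (h : IsPerfectMatching G M) {v w w' : V} (hw : s(v, w) ∈ M) (hw' : s(v, w') ∈ M) : w = w' :=
  ((isPerfectMatching_iff.1 h).2 v).unique hw hw'

/-- An edge in exactly one of two perfect matchings is not a bridge. -/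
theorem IsPerfectMatching.reachable_deleteEdges [Finite V] {G : SimpleGraph V}
    {M N : Set (Sym2 V)} (hM : IsPerfectMatching G M) (hN : IsPerfectMatching G N) {v w : V}
    (hvM : s(v, w) ∈ M) (hvN : s(v, w) ∉ N) : (G.deleteEdges {s(v, w)}).Reachable v w := by
  obtain ⟨H, hH, rfl⟩ := hM
  obtain ⟨K, hK, rfl⟩ := hN
  -- The symmetric difference of two perfect matchings is a disjoint union of cycles, one of which
  -- contains `vw`.
  have hc := hH.symmDiff_isCycles hK
  have hadj : (symmDiff H.spanningCoe K.spanningCoe).Adj v w := by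
    rw [symmDiff_def, sup_adj, sdiff_adj]
    exact Or.inl ⟨hvM, hvN⟩
  refine (IsCycles.reachable_deleteEdges hadj hc).mono (deleteEdges_mono ?_)
  rw [symmDiff_def]
  exact sup_le (sdiff_le.trans H.spanningCoe_le) (sdiff_le.trans K.spanningCoe_le)

theorem IsPerfectMatching.subset_of_isAcyclic [Finite V] {F : SimpleGraph V}
    (hF : F.IsAcyclic) {M N : Set (Sym2 V)} (hM : IsPerfectMatching F M)
    (hN : IsPerfectMatching F N) : M ⊆ N := by
  intro e he
  induction e with
  | _ v w =>
    by_contra hn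
    exact isBridge_iff.1 (isAcyclic_iff_forall_isBridge.1 hF (hM.subset he))
      (hM.reachable_deleteEdges hN he hn)

/-- A forest has at most one perfect matching. -/
theorem IsPerfectMatching.eq_of_isAcyclic [Finite V] {F : SimpleGraph V}
    (hF : F.IsAcyclic) {M N : Set (Sym2 V)} (hM : IsPerfectMatching F M)
    (hN : IsPerfectMatching F N) : M = N :=
  (hM.subset_of_isAcyclic hF hN).antisymm (hN.subset_of_isAcyclic hF hM)

theorem not_reachable_of_forall_not_adj {G : SimpleGraph V} {v w : V} (hvw : v ≠ w)
    (h : ∀ x, ¬ G.Adj v x) : ¬ G.Reachable v w := by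
  rintro ⟨p⟩
  cases p with
  | nil => exact hvw rfl
  | cons hadj _ => exact h _ hadj

theorem IsPerfectMatching.isAcyclic_fromEdgeSet {G : SimpleGraph V} {M : Set (Sym2 V)}
    (h : IsPerfectMatching G M) : (fromEdgeSet M).IsAcyclic := by
  rw [isAcyclic_iff_forall_adj_isBridge]
  intro v w hvw
  rw [isBridge_iff]
  refine not_reachable_of_forall_not_adj hvw.ne fun x hx => ?_
  rw [deleteEdges_adj, fromEdgeSet_adj] at hx
  rw [fromEdgeSet_adj] at hvw
  exact hx.2 (by rw [h.eq_of_mem hx.1.1 hvw.1]; rfl)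

/-- If `va` and `vb` are two edges of a graph at a common vertex, outside the perfect matching `M`,
and removing either one leaves a forest, then `M` is the unique perfect matching. -/
theorem IsPerfectMatching.eq_of_isAcyclic_deleteEdges [Finite V] {H : SimpleGraph V}
    {M N : Set (Sym2 V)} (hM : IsPerfectMatching H M) (hN : IsPerfectMatching H N) {v a b : V}
    (hab : a ≠ b) (ha : s(v, a) ∉ M) (hb : s(v, b) ∉ M)
    (hFa : (H.deleteEdges {s(v, a)}).IsAcyclic) (hFb : (H.deleteEdges {s(v, b)}).IsAcyclic) :
    N = M := by
  -- `N` cannot contain both `va` and `vb`; the one it omits can be removed, leaving a forest that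
  -- contains both matchings.
  have key : ∀ e, e ∉ M → e ∉ N → (H.deleteEdges {e}).IsAcyclic → N = M := by
    intro e heM heN hF
    refine IsPerfectMatching.eq_of_isAcyclic hF (hN.mono ?_) (hM.mono ?_)
    · rw [edgeSet_deleteEdges]
      exact fun x hx => ⟨hN.subset hx, fun h => heN (h ▸ hx)⟩
    · rw [edgeSet_deleteEdges]
      exact fun x hx => ⟨hM.subset hx, fun h => heM (h ▸ hx)⟩
  by_cases h : s(v, a) ∈ N
  · exact key _ hb (fun h' => hab (hN.eq_of_mem h h')) hFb
  · exact key _ ha h hFa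

/-! ### Upper bounds on the anti-forcing number -/

/-- A subgraph in which `M` is the unique perfect matching bounds the anti-forcing number. -/
theorem af_add_ncard_le [Finite V] {G H : SimpleGraph V} {M : Set (Sym2 V)} (hHG : H ≤ G)
    (hM : IsPerfectMatching H M) (huniq : ∀ N, IsPerfectMatching H N → N = M) :
    af G M + H.edgeSet.ncard ≤ G.edgeSet.ncard := by
  have hsub : H.edgeSet ⊆ G.edgeSet := edgeSet_mono hHG
  have hdel : G.deleteEdges (G.edgeSet \ H.edgeSet) = H := by
    rw [← edgeSet_inj, edgeSet_deleteEdges, Set.sdiff_sdiff_cancel_left hsub]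
  have hS : IsAntiForcingSet G M (G.edgeSet \ H.edgeSet) := by
    refine ⟨Set.sdiff_subset_sdiff_right hM.subset, fun N => ?_⟩
    rw [hdel]
    exact ⟨huniq N, fun h => h ▸ hM⟩
  have hle : af G M ≤ (G.edgeSet \ H.edgeSet).ncard := Nat.sInf_le ⟨_, hS, rfl⟩
  have := Set.ncard_sdiff_add_ncard_of_subset hsub (Set.toFinite _)
  omega

theorem IsElementary.connected {G : SimpleGraph V} (hG : IsElementary G) : G.Connected := by
  refine hG.2.mono fun v w h => ?_
  obtain ⟨⟨M, hM, he⟩, -⟩ := (fromEdgeSet_adj _).1 h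
  exact hM.adj he

theorem cyclomaticNumber_of_connected {G : SimpleGraph V} (hG : G.Connected) :
    cyclomaticNumber G = (G.edgeSet.ncard : ℤ) - Nat.card V + 1 := by
  have := hG.preconnected.subsingleton_connectedComponent
  have := hG.nonempty
  have : Nonempty G.ConnectedComponent := ⟨G.connectedComponentMk this.some⟩
  rw [cyclomaticNumber, Nat.card_of_subsingleton this.some, Nat.cast_one]

/-- If two neighbours `a`, `b` of `v` are joined by a walk that avoids the `M`-edge `vu`, then a
spanning tree containing `M` and `vb`, together with the edge `va`, has `M` as its unique perfect
matching; so `af(G, M) < r(G)`. -/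
theorem af_lt_cyclomaticNumber [Finite V] {G : SimpleGraph V} (hG : G.Connected)
    {M : Set (Sym2 V)} (hM : IsPerfectMatching G M) {v u a b : V} (hvu : s(v, u) ∈ M)
    (hva : G.Adj v a) (hvb : G.Adj v b) (hab : a ≠ b) (p : G.Walk a b) (hpv : v ∉ p.support)
    (hpu : u ∉ p.support) : (af G M : ℤ) < cyclomaticNumber G := by
  have hadj : G.Adj v u := hM.adj hvu
  have hau : a ≠ u := fun h => hpu (h ▸ p.start_mem_support)
  have hbu : b ≠ u := fun h => hpu (h ▸ p.end_mem_support)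
  have haM : s(v, a) ∉ M := fun h => hau (hM.eq_of_mem h hvu)
  have hbM : s(v, b) ∉ M := fun h => hbu (hM.eq_of_mem h hvu)
  have huv : s(u, v) ∈ M := by rwa [Sym2.eq_swap]
  -- In `K` the edge `vu` is a whole component, while `M` and the walk `p` survive.
  set K : SimpleGraph V := G.deleteEdges {e | (v ∈ e ∨ u ∈ e) ∧ e ≠ s(v, u)} with hK
  have hKadj : ∀ x y, K.Adj x y ↔
      G.Adj x y ∧ ((v ∈ s(x, y) ∨ u ∈ s(x, y)) → s(x, y) = s(v, u)) := by
    intro x y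
    rw [hK, deleteEdges_adj, Set.mem_ofPred_eq]
    tauto
  have hKG : K ≤ G := deleteEdges_le _
  have hMK : fromEdgeSet M ≤ K := by
    intro x y hxy
    rw [fromEdgeSet_adj] at hxy
    refine (hKadj x y).2 ⟨hM.adj hxy.1, fun h => ?_⟩
    have hyx : s(y, x) ∈ M := by rw [Sym2.eq_swap]; exact hxy.1
    rcases h with h | h <;> rcases Sym2.mem_iff.1 h with rfl | rfl
    · rw [hM.eq_of_mem hxy.1 hvu]
    · rw [hM.eq_of_mem hyx hvu, Sym2.eq_swap]
    · rw [hM.eq_of_mem hxy.1 huv, Sym2.eq_swap]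
    · rw [hM.eq_of_mem hyx huv]
  have hreachK : K.Reachable a b := by
    refine ⟨p.transfer K fun e he => ?_⟩
    induction e with
    | _ x y =>
      refine (hKadj x y).2 ⟨p.adj_of_mem_edges he, fun h => ?_⟩
      have hx := p.fst_mem_support_of_mem_edges he
      have hy := p.snd_mem_support_of_mem_edges he
      rcases h with h | h <;> rcases Sym2.mem_iff.1 h with rfl | rfl <;> contradiction
  have hcomp : ∀ x y, K.Reachable x y → (x = v ∨ x = u) → (y = v ∨ y = u) := by
    rintro x y ⟨q⟩
    induction q with
    | nil => exact id
    | @cons x z y h q ih =>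
      intro hx
      refine ih ?_
      have h1 : s(x, z) = s(v, u) := ((hKadj x z).1 h).2 (by
        rcases hx with rfl | rfl
        · exact Or.inl (Sym2.mem_mk_left _ _)
        · exact Or.inr (Sym2.mem_mk_left _ _))
      have : z ∈ s(v, u) := h1 ▸ Sym2.mem_mk_right x z
      exact Sym2.mem_iff.1 this
  -- A spanning forest of `K` containing `M`: it joins `a` to `b` but not to `v`, so `vb` can be
  -- added without creating a cycle.
  obtain ⟨F, hMF, hFK, hF, hFreach⟩ :=
    exists_isAcyclic_reachable_eq_le_of_le_of_isAcyclic hMK hM.isAcyclic_fromEdgeSet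
  have hFab : F.Reachable a b := by rw [hFreach]; exact hreachK
  have hFvb : ¬ F.Reachable v b := by
    rw [hFreach]
    intro h
    rcases hcomp v b h (Or.inl rfl) with h | h
    · exact hvb.ne h.symm
    · exact hbu h
  obtain ⟨T, hFT, hTG, hT⟩ := hG.exists_isTree_le_of_le_of_isAcyclic
    (sup_le (hFK.trans hKG) ((edge_le_iff _).2 (Or.inr hvb)))
    (hF.sup_edge_of_not_reachable hFvb)
  have hTvb : T.Adj v b := hFT (Or.inr ((edge_adj ..).2 ⟨Or.inl ⟨rfl, rfl⟩, hvb.ne⟩))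
  have hFT' : F ≤ T.deleteEdges {s(v, b)} := by
    intro x y hxy
    refine deleteEdges_adj.2 ⟨hFT (Or.inl hxy), fun h => hFvb ?_⟩
    have : F.Adj v b := by rw [← mem_edgeSet, ← Set.mem_singleton_iff.1 h]; exact hxy
    exact this.reachable
  have hTab : (T.deleteEdges {s(v, b)}).Reachable a b := hFab.mono hFT'
  -- The `T`-path from `v` to `a` therefore starts with `vb`, and adding `va` closes a cycle through
  -- both edges.
  have hTva : ¬ (T.deleteEdges {s(v, b)}).Reachable v a := fun h =>
    isBridge_iff.1 (isAcyclic_iff_forall_isBridge.1 hT.isAcyclic hTvb) (h.trans hTab)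
  have hvaT : s(v, a) ∉ T.edgeSet := by
    intro h
    refine hTva (Adj.reachable (deleteEdges_adj.2 ⟨h, fun h' => hab ?_⟩))
    exact Sym2.congr_right.1 (Set.mem_singleton_iff.1 h')
  set H : SimpleGraph V := T ⊔ edge v a with hH
  have hHset : H.edgeSet = insert s(v, a) T.edgeSet := by
    rw [hH, edgeSet_sup, edgeSet_edge_of_ne hva.ne, Set.union_singleton]
  have hHG : H ≤ G := sup_le hTG ((edge_le_iff _).2 (Or.inr hva))
  have hMH : IsPerfectMatching H M := by
    refine hM.mono fun e he => ?_
    have : e ∈ (fromEdgeSet M).edgeSet := by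
      rw [edgeSet_fromEdgeSet]
      exact ⟨he, G.not_isDiag_of_mem_edgeSet (hM.subset he)⟩
    exact edgeSet_mono (hMF.trans ((le_sup_left.trans hFT).trans le_sup_left)) this
  have hFa : (H.deleteEdges {s(v, a)}).IsAcyclic := by
    refine hT.isAcyclic.anti ?_
    rw [← edgeSet_subset_edgeSet, edgeSet_deleteEdges, hHset]
    rintro e ⟨rfl | he, he'⟩
    · exact absurd rfl he'
    · exact he
  have hFb : (H.deleteEdges {s(v, b)}).IsAcyclic := by
    refine IsAcyclic.anti ?_ ((hT.isAcyclic.anti (deleteEdges_le {s(v, b)})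
      ).sup_edge_of_not_reachable hTva)
    rw [hH, deleteEdges_sup]
    exact sup_le_sup_left (deleteEdges_le _) _
  have hle := af_add_ncard_le hHG hMH fun N hN =>
    hMH.eq_of_isAcyclic_deleteEdges hN hab haM hbM hFa hFb
  -- A tree plus one edge has `|V|` edges, whence `af(G, M) ≤ |E| - |V| = r(G) - 1`.
  have hcard : H.edgeSet.ncard = Nat.card V := by
    rw [hHset, Set.ncard_insert_of_notMem hvaT (Set.toFinite _)]
    exact (isTree_iff_connected_and_card.1 hT).2
  rw [cyclomaticNumber_of_connected hG]
  omega

/-! ### Two extremal matchings in an elementary graph -/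

/-- In an elementary graph an edge outside some perfect matching is not a bridge. -/
theorem IsElementary.reachable_deleteEdges [Finite V] {G : SimpleGraph V} (hG : IsElementary G)
    {M : Set (Sym2 V)} (hM : IsPerfectMatching G M) {v x : V} (hvM : s(v, x) ∉ M) :
    (G.deleteEdges {s(v, x)}).Reachable v x := by
  -- An allowed edge lies on an alternating cycle; a forbidden one is bypassed by the connected
  -- allowed subgraph.
  by_cases h : ∃ N, IsPerfectMatching G N ∧ s(v, x) ∈ N
  · obtain ⟨N, hN, hvN⟩ := h
    exact hN.reachable_deleteEdges hM hvN hvM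
  · refine (hG.2.preconnected v x).mono fun y z hyz => ?_
    obtain ⟨⟨N, hN, he⟩, -⟩ := (fromEdgeSet_adj _).1 hyz
    exact deleteEdges_adj.2 ⟨hN.adj he, fun h' => h ⟨N, hN, h' ▸ he⟩⟩

/-- If `G` has two perfect matchings of anti-forcing number at least `r(G)`, then a vertex matched
differently by them has no further neighbours. -/
theorem IsElementary.eq_or_eq_of_adj [Finite V] {G : SimpleGraph V} (hG : IsElementary G)
    {M N : Set (Sym2 V)} (hM : IsPerfectMatching G M) (hN : IsPerfectMatching G N)
    (hafM : cyclomaticNumber G ≤ af G M) (hafN : cyclomaticNumber G ≤ af G N) {v m n x : V}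
    (hm : s(v, m) ∈ M) (hn : s(v, n) ∈ N) (hmn : m ≠ n) (hx : G.Adj v x) : x = m ∨ x = n := by
  classical
  by_contra! hne
  obtain ⟨hxm, hxn⟩ := hne
  have hvM : s(v, x) ∉ M := fun h => hxm (hM.eq_of_mem h hm)
  obtain ⟨p⟩ := hG.reachable_deleteEdges hM hvM
  obtain ⟨p, hp⟩ := p.toPath
  cases p with
  | nil => exact hx.ne rfl
  | @cons _ y _ hvy q =>
    rw [Walk.cons_isPath_iff] at hp
    obtain ⟨hq, hvq⟩ := hp
    rw [deleteEdges_adj] at hvy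
    have hyx : x ≠ y := fun h => hvy.2 (by rw [h]; rfl)
    have noWalkM : ∀ {y} (q : G.Walk x y), v ∉ q.support → G.Adj v y → x ≠ y → m ∈ q.support := by
      intro y q hv hy hxy
      by_contra hmq
      exact (af_lt_cyclomaticNumber hG.connected hM hm hx hy hxy q hv hmq).not_ge hafM
    have noWalkN : ∀ {y} (q : G.Walk x y), v ∉ q.support → G.Adj v y → x ≠ y → n ∈ q.support := by
      intro y q hv hy hxy
      by_contra hnq
      exact (af_lt_cyclomaticNumber hG.connected hN hn hx hy hxy q hv hnq).not_ge hafN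
    set q' : G.Walk x y := (q.mapLe (deleteEdges_le _)).reverse with hq'
    have hvq' : v ∉ q'.support := by simpa [hq'] using hvq
    -- Each truncation ends at a neighbour of `v` other than `x`, so the walk obstruction applies
    -- again.
    have hmq := noWalkM q' hvq' hvy.1 hyx
    have hv₁ : v ∉ (q'.takeUntil m hmq).support :=
      fun h => hvq' (q'.support_takeUntil_subset_support hmq h)
    have hq'p : q'.IsPath := by simpa [hq'] using hq
    have hnq := noWalkN (q'.takeUntil m hmq) hv₁ (hM.adj hm) hxm
    have hv₂ : v ∉ ((q'.takeUntil m hmq).takeUntil n hnq).support :=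
      fun h => hv₁ ((q'.takeUntil m hmq).support_takeUntil_subset_support hnq h)
    have hm₂ := noWalkM _ hv₂ (hN.adj hn) hxn
    exact Walk.endpoint_notMem_support_takeUntil (hq'p.takeUntil hmq) hnq hmn hm₂

theorem ncard_edgeSet_of_forall_degree_eq_two [Fintype V] {G : SimpleGraph V}
    [DecidableRel G.Adj] (h : ∀ v, G.degree v = 2) : G.edgeSet.ncard = Nat.card V := by
  have hs := G.sum_degrees_eq_twice_card_edges
  simp only [h, Finset.sum_const, Finset.card_univ, smul_eq_mul] at hs
  rw [Set.ncard_eq_toFinset_card', Nat.card_eq_fintype_card]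
  change G.edgeFinset.card = _
  omega

/-- In an elementary graph of cyclomatic number at least two, at most one perfect matching has
anti-forcing number `r(G)`. -/
theorem IsElementary.eq_of_cyclomaticNumber_le_af [Finite V] {G : SimpleGraph V}
    (hG : IsElementary G) (hr : 2 ≤ cyclomaticNumber G) {M N : Set (Sym2 V)}
    (hM : IsPerfectMatching G M) (hN : IsPerfectMatching G N)
    (hafM : cyclomaticNumber G ≤ af G M) (hafN : cyclomaticNumber G ≤ af G N) : M = N := by
  classical
  have := Fintype.ofFinite V
  choose m hm _ using (isPerfectMatching_iff.1 hM).2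
  choose n hn _ using (isPerfectMatching_iff.1 hN).2
  have hm' : ∀ v, s(m v, v) ∈ M := fun v => by rw [Sym2.eq_swap]; exact hm v
  have hn' : ∀ v, s(n v, v) ∈ N := fun v => by rw [Sym2.eq_swap]; exact hn v
  by_cases hall : ∀ v, m v = n v
  · ext e
    induction e with
    | _ v w =>
      constructor
      · intro h
        rw [hM.eq_of_mem h (hm v), hall]
        exact hn v
      · intro h
        rw [hN.eq_of_mem h (hn v), ← hall]
        exact hm v
  · exfalso
    push Not at hall
    obtain ⟨v₀, hv₀⟩ := hall
    have hnbr : ∀ v, m v ≠ n v → ∀ x, G.Adj v x → x = m v ∨ x = n v := fun v hv x hx =>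
      hG.eq_or_eq_of_adj hM hN hafM hafN (hm v) (hn v) hv hx
    -- A neighbour of `v` is a partner of `v` in one matching; were its two partners equal, both
    -- would be `v`, and then `m v = n v`.
    have hstep : ∀ v x, G.Adj v x → m v ≠ n v → m x ≠ n x := by
      intro v x hvx hv heq
      rcases hnbr v hv x hvx with rfl | rfl
      · have h₁ : m (m v) = v := hM.eq_of_mem (hm _) (hm' v)
        have h₂ := hn' (m v)
        rw [← heq, h₁] at h₂
        exact hv (hN.eq_of_mem h₂ (hn v))
      · have h₁ : n (n v) = v := hN.eq_of_mem (hn _) (hn' v)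
        have h₂ := hm' (n v)
        rw [heq, h₁] at h₂
        exact hv (hM.eq_of_mem (hm v) h₂)
    have hne : ∀ v, m v ≠ n v := by
      intro v
      obtain ⟨p⟩ := hG.connected.preconnected v₀ v
      induction p with
      | nil => exact hv₀
      | cons h _ ih => exact ih (hstep _ _ h hv₀)
    have hdeg : ∀ v, G.degree v = 2 := by
      intro v
      have : G.neighborFinset v = {m v, n v} := by
        ext x
        rw [mem_neighborFinset, Finset.mem_insert, Finset.mem_singleton]
        refine ⟨hnbr v (hne v) x, ?_⟩
        rintro (rfl | rfl)
        · exact hM.adj (hm v)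
        · exact hN.adj (hn v)
      rw [← card_neighborFinset_eq_degree, this, Finset.card_pair (hne v)]
    have := ncard_edgeSet_of_forall_degree_eq_two hdeg
    rw [cyclomaticNumber_of_connected hG.connected] at hr
    omega

end AntiForcing

theorem corollary3p6 {V : Type*} [Finite V] (G : SimpleGraph V)
    (hG : AntiForcing.IsElementary G)
    (hr : 2 ≤ AntiForcing.cyclomaticNumber G)
    (hAf : (AntiForcing.maxAf G : ℤ) = AntiForcing.cyclomaticNumber G) :
    ∃! M : Set (Sym2 V), AntiForcing.IsPerfectMatching G M ∧
      (AntiForcing.af G M : ℤ) = AntiForcing.cyclomaticNumber G := by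
  obtain ⟨M, hM, haf⟩ := (AntiForcing.isGreatest_maxAf hG.1).1
  refine ⟨M, ⟨hM, by rw [haf, hAf]⟩, fun N hN => ?_⟩
  exact hG.eq_of_cyclomaticNumber_le_af hr hN.1 hM hN.2.ge (by rw [haf, hAf])
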